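/- For $n\ge 1$ and $\lambda\in\mathbb{C}$ let $J_n(\lambda)$ be the $n\times n$ Jordan cell with $\lambda$ on the diagonal and $1$ on the first superdiagonal, write $\backsim$ for similarity of complex square matrices and $\oplus$ for block-diagonal direct sum. For positive integers $p,q$ and complex matrices $A=(A_{ij})_{0\le i,j\le p-1}$, $B=(B_{ij})_{0\le i,j\le q-1}$ let $$\rho_{p,q}(A\otimes B)=\sum_{i_1,j_1=0}^{p-1}\ \sum_{i_2,j_2=0}^{q-1}A_{i_1j_1}B_{i_2j_2}\,E_{\,i_1+p\,i_2,\;j_1+p\,j_2},$$ where the $E_{I,J}$, $0\le I,J\le pq-1$, are the $pq\times pq$ matrix units (this is the Kronecker product of $A$ and $B$, up to ordering of the basis). **Theorem.** Let $p,q$ be positive integers and $a,b\in\mathbb{C}$. 1. If $ab\neq 0$, then $\displaystyle \rho_{p,q}(J_p(a)\otimes J_q(b))\backsim\bigoplus_{k=1}^{\min\{p,q\}}J_{p+q-2k+1}(ab).$ 2. If $a\neq 0$, then $\displaystyle \rho_{p,q}(J_p(a)\otimes J_q(0))\backsim\bigoplus_{k=1}^{p}J_q(0).$ 3. If $b\neq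 0$, then $\displaystyle \rho_{p,q}(J_p(0)\otimes J_q(b))\backsim\bigoplus_{k=1}^{q}J_p(0).$ 4. $\displaystyle \rho_{p,q}(J_p(0)\otimes J_q(0))\backsim\Bigl(\bigoplus_{k=1}^{\min\{p,q\}-1}\bigl(J_k(0)\oplus J_k(0)\bigr)\Bigr)\oplus\bigoplus_{k=1}^{|p-q|+1}J_{\min\{p,q\}}(0).$ -/

import Mathlib

open scoped Kronecker

/-- The Jordan cell `J_n(a)` of size `n` with eigenvalue `a`: `a` on the diagonal and `1` on the
first superdiagonal. -/
def jordanCell (n : ℕ) (a : ℂ) : Matrix (Fin n) (Fin n) ℂ :=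
  Matrix.of fun i j => if i = j then a else if (i : ℕ) + 1 = (j : ℕ) then 1 else 0

/-- The position `I = i₁ + p i₂` in `{0, …, p q - 1}` of the pair `(i₁, i₂)`. -/
def tensorIndex (p q : ℕ) (i : Fin p × Fin q) : Fin (p * q) :=
  ⟨(i.1 : ℕ) + p * (i.2 : ℕ), by
    have h1 := i.1.isLt
    have h2 : p * ((i.2 : ℕ) + 1) ≤ p * q := Nat.mul_le_mul_left p i.2.isLt
    rw [Nat.mul_add, Nat.mul_one] at h2
    omega⟩

/-- The tensor product map `ρ_{p,q}(T) = ∑ T_{i₁,j₁,i₂,j₂} E_{I,J}`, with `I = i₁ + p i₂` and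
`J = j₁ + p j₂`. A tensor in `Mat(p) ⊗ Mat(q)` is identified with the matrix of its coefficients
`T_{(i₁,i₂),(j₁,j₂)}`; the one of `A ⊗ B` is `A i₁ j₁ * B i₂ j₂`, that is `A ⊗ₖ B`. -/
def tensorProductMap (p q : ℕ) (T : Matrix (Fin p × Fin q) (Fin p × Fin q) ℂ) :
    Matrix (Fin (p * q)) (Fin (p * q)) ℂ :=
  ∑ i : Fin p × Fin q, ∑ j : Fin p × Fin q,
    Matrix.single (tensorIndex p q i) (tensorIndex p q j) (T i j)

/-- Similarity `D = U C U⁻¹` of complex square matrices. The index sets may be different types of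
the same size; they are then identified by a bijection. -/
def MatSimilar {m n : Type*} [Fintype n] [DecidableEq n]
    (C : Matrix m m ℂ) (D : Matrix n n ℂ) : Prop :=
  ∃ (e : m ≃ n) (U : Matrix n n ℂ), IsUnit U ∧ D = U * Matrix.reindex e e C * U⁻¹

/-- The direct sum `C ⊕ D` of two square matrices. -/
def matDirectSum {m n : Type*} (C : Matrix m m ℂ) (D : Matrix n n ℂ) :
    Matrix (m ⊕ n) (m ⊕ n) ℂ :=
  Matrix.fromBlocks C 0 0 D

/-! Write `N_n` for the nilpotent cell. `ρ_{p,q}` only relabels the basis, so everything takes place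
on `Fin p × Fin q`.

An invertible left factor can be removed: `B ⊗ N_p` is conjugate to `1 ⊗ N_p` through powers of `B`
(`Intertwined.kronecker_jordanCell_zero`). This settles the two cases with exactly one nilpotent
factor.

If `ab ≠ 0`, subtracting the scalar `ab` leaves `J_p(a) ⊗ N_q + b N_p ⊗ 1`. Removing `J_p(a)` and
then `b` turns this into `N_p ⊗ 1 + 1 ⊗ N_q`, the lowering operator of `sl₂` on a tensor product of
irreducibles of dimensions `p` and `q`. Clebsch-Gordan then gives the cells: each explicit highest
weight vector generates one Jordan chain. The chain ends have distinct weights, so they are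
independent, and the lengths add up to `pq` (`Intertwined.of_chains`,
`Intertwined.kroneckerSum_jordanCell_zero`).

If both factors are nilpotent, `N_p ⊗ N_q` moves basis vectors one step along the diagonals of a `p
× q` rectangle, and each diagonal is a Jordan chain. -/

/-- `C` and `D`, indexed by possibly different types, are conjugate by a rectangular matrix with a
two-sided inverse. -/
def Intertwined {m n : Type*} [Fintype m] [Fintype n] [DecidableEq m] [DecidableEq n]
    (C : Matrix m m ℂ) (D : Matrix n n ℂ) : Prop :=
  ∃ (P : Matrix m n ℂ) (Q : Matrix n m ℂ), P * Q = 1 ∧ Q * P = 1 ∧ C * P = P * D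

/-! ### Conjugation by rectangular matrices -/

section Intertwined

variable {l m n : Type*} [Fintype l] [Fintype m] [Fintype n]
  [DecidableEq l] [DecidableEq m] [DecidableEq n]

theorem Intertwined.trans {B : Matrix l l ℂ} {C : Matrix m m ℂ} {D : Matrix n n ℂ}
    (h₁ : Intertwined B C) (h₂ : Intertwined C D) : Intertwined B D := by
  obtain ⟨P, Q, hPQ, hQP, hP⟩ := h₁
  obtain ⟨R, S, hRS, hSR, hR⟩ := h₂
  refine ⟨P * R, S * Q, ?_, ?_, ?_⟩
  · rw [Matrix.mul_assoc, ← Matrix.mul_assoc R, hRS, Matrix.one_mul, hPQ]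
  · rw [Matrix.mul_assoc, ← Matrix.mul_assoc Q, hQP, Matrix.one_mul, hSR]
  · rw [← Matrix.mul_assoc, hP, Matrix.mul_assoc, hR, Matrix.mul_assoc]

theorem Intertwined.reindex (e : m ≃ n) (C : Matrix m m ℂ) :
    Intertwined (Matrix.reindex e e C) C := by
  refine ⟨(1 : Matrix m m ℂ).submatrix e.symm id, (1 : Matrix m m ℂ).submatrix id e.symm,
    ?_, ?_, ?_⟩
  · rw [Matrix.submatrix_mul _ _ _ _ _ Function.bijective_id |>.symm, Matrix.one_mul,
      Matrix.submatrix_one_equiv]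
  · rw [Matrix.submatrix_mul _ _ _ _ _ e.symm.bijective |>.symm, Matrix.one_mul,
      Matrix.submatrix_id_id]
  · have h : C.submatrix e.symm e.symm * (1 : Matrix m m ℂ).submatrix e.symm id
        = C.submatrix e.symm id := by
      rw [Matrix.submatrix_mul _ _ _ _ _ e.symm.bijective |>.symm, Matrix.mul_one]
    rw [Matrix.reindex_apply, h]
    conv_rhs => rw [← Matrix.submatrix_id_id C]
    rw [Matrix.submatrix_mul _ _ _ _ _ Function.bijective_id |>.symm, Matrix.one_mul]

theorem Intertwined.smul_one_add {C : Matrix m m ℂ} {D : Matrix n n ℂ} (c : ℂ)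
    (h : Intertwined C D) : Intertwined (c • 1 + C) (c • 1 + D) := by
  obtain ⟨P, Q, hPQ, hQP, hP⟩ := h
  exact ⟨P, Q, hPQ, hQP, by simp [Matrix.add_mul, Matrix.mul_add, hP]⟩

theorem Intertwined.matSimilar {C : Matrix m m ℂ} {D : Matrix n n ℂ} (h : Intertwined C D) :
    MatSimilar C D := by
  obtain ⟨P, Q, hPQ, hQP, hP⟩ := h
  -- Any bijection will do, since the conjugating matrix absorbs the choice.
  have e : m ≃ n := Fintype.equivOfCardEq (Matrix.square_of_invertible P Q hPQ hQP)
  have h₁ : Q.submatrix id e.symm * P.submatrix e.symm id = 1 := by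
    rw [Matrix.submatrix_mul _ _ _ _ _ e.symm.bijective |>.symm, hQP, Matrix.submatrix_id_id]
  refine ⟨e, Q.submatrix id e.symm, IsUnit.of_mul_eq_one _ h₁, ?_⟩
  rw [Matrix.inv_eq_right_inv h₁, Matrix.reindex_apply,
    Matrix.submatrix_mul _ _ _ _ _ e.symm.bijective |>.symm,
    Matrix.submatrix_mul _ _ _ _ _ e.symm.bijective |>.symm, Matrix.submatrix_id_id,
    Matrix.mul_assoc, hP, ← Matrix.mul_assoc, hQP, Matrix.one_mul]

/-- A linearly independent family of the right size on which `C` acts through the columns of `D`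
conjugates `C` to `D`. -/
theorem Intertwined.of_linearIndependent [Nonempty n] {C : Matrix m m ℂ} {D : Matrix n n ℂ}
    (w : n → m → ℂ) (hw : LinearIndependent ℂ w) (hcard : Fintype.card n = Fintype.card m)
    (h : ∀ j, C.mulVec (w j) = ∑ i, D i j • w i) : Intertwined C D := by
  let b := basisOfLinearIndependentOfCardEqFinrank hw (by simpa using hcard)
  have hb : ∀ j, b j = w j := fun j => by simp [b]
  have hP : ∀ i j, (Pi.basisFun ℂ m).toMatrix b i j = w j i := fun i j => by
    simp [Module.Basis.toMatrix_apply, hb]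
  refine ⟨(Pi.basisFun ℂ m).toMatrix b, b.toMatrix (Pi.basisFun ℂ m),
    Module.Basis.toMatrix_mul_toMatrix_flip _ _, Module.Basis.toMatrix_mul_toMatrix_flip _ _, ?_⟩
  ext i j
  have := congrFun (h j) i
  simp only [Matrix.mul_apply, hP]
  simp only [Matrix.mulVec, dotProduct, Finset.sum_apply, Pi.smul_apply, smul_eq_mul] at this
  rw [this]
  exact Finset.sum_congr rfl fun k _ => mul_comm _ _

end Intertwined

/-! ### Relabelling and untwisting of Kronecker products -/

theorem tensorIndex_bijective (p q : ℕ) : Function.Bijective (tensorIndex p q) := by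
  have h : tensorIndex p q = (finCongr (Nat.mul_comm q p)) ∘ finProdFinEquiv ∘ Prod.swap := by
    ext x
    simp [tensorIndex, finProdFinEquiv]
  rw [h]
  exact (finCongr _).bijective.comp (finProdFinEquiv.bijective.comp Prod.swap_bijective)

theorem tensorProductMap_eq_reindex (p q : ℕ)
    (T : Matrix (Fin p × Fin q) (Fin p × Fin q) ℂ) :
    tensorProductMap p q T = Matrix.reindex (Equiv.ofBijective _ (tensorIndex_bijective p q))
      (Equiv.ofBijective _ (tensorIndex_bijective p q)) T := by
  ext I J
  obtain ⟨i, rfl⟩ := (tensorIndex_bijective p q).2 I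
  obtain ⟨j, rfl⟩ := (tensorIndex_bijective p q).2 J
  have hinj := (tensorIndex_bijective p q).1
  have e : ∀ x, (Equiv.ofBijective _ (tensorIndex_bijective p q)).symm (tensorIndex p q x) = x :=
    fun x => Equiv.ofBijective_symm_apply_apply _ _ x
  simp only [tensorProductMap, Matrix.sum_apply, Matrix.single_apply, Matrix.reindex_apply,
    Matrix.submatrix_apply, e, hinj.eq_iff, ite_and]
  simp

theorem Intertwined.matSimilar_tensorProductMap {p q : ℕ} {n : Type*} [Fintype n] [DecidableEq n]
    {T : Matrix (Fin p × Fin q) (Fin p × Fin q) ℂ} {D : Matrix n n ℂ} (h : Intertwined T D) :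
    MatSimilar (tensorProductMap p q T) D := by
  rw [tensorProductMap_eq_reindex]
  exact ((Intertwined.reindex _ T).trans h).matSimilar

theorem Intertwined.kronecker_swap {m n : Type*} [Fintype m] [Fintype n] [DecidableEq m]
    [DecidableEq n] (A : Matrix m m ℂ) (B : Matrix n n ℂ) : Intertwined (A ⊗ₖ B) (B ⊗ₖ A) := by
  have h : A ⊗ₖ B = Matrix.reindex (Equiv.prodComm n m) (Equiv.prodComm n m) (B ⊗ₖ A) := by
    ext i j
    simp [mul_comm]
  rw [h]
  exact Intertwined.reindex _ _

theorem Intertwined.blockDiagonal'_const {κ : Type*} [Fintype κ] [DecidableEq κ] (n : ℕ)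
    (B : Matrix (Fin n) (Fin n) ℂ) :
    Intertwined (B ⊗ₖ (1 : Matrix κ κ ℂ)) (Matrix.blockDiagonal' fun _ : κ => B) := by
  have h : B ⊗ₖ (1 : Matrix κ κ ℂ) = Matrix.reindex
      ((Equiv.sigmaEquivProd κ (Fin n)).trans (Equiv.prodComm _ _))
      ((Equiv.sigmaEquivProd κ (Fin n)).trans (Equiv.prodComm _ _))
      (Matrix.blockDiagonal' fun _ : κ => B) := by
    ext ⟨i, k⟩ ⟨j, l⟩
    by_cases h : k = l
    · subst h
      simp [Matrix.blockDiagonal'_apply]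
    · simp [Matrix.blockDiagonal'_apply, h]
  rw [h]
  exact Intertwined.reindex _ _

/-- Conjugation by the block-diagonal matrix with blocks `B ^ (-i)` turns `B ⊗ J_p(0)` into
`1 ⊗ J_p(0)`, and fixes `Y ⊗ 1` when `Y` commutes with `B`. -/
theorem Intertwined.kronecker_jordanCell_zero (p : ℕ) {n : Type*} [Fintype n] [DecidableEq n]
    (B Y : Matrix n n ℂ) (hB : IsUnit B) (hY : Commute B Y) :
    Intertwined (B ⊗ₖ jordanCell p 0 + Y ⊗ₖ 1) (1 ⊗ₖ jordanCell p 0 + Y ⊗ₖ 1) := by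
  obtain ⟨u, rfl⟩ := hB
  have hYi : Commute (↑u⁻¹ : Matrix n n ℂ) Y := hY.units_inv_left
  refine ⟨Matrix.blockDiagonal fun i : Fin p => (↑u⁻¹ : Matrix n n ℂ) ^ (i : ℕ),
    Matrix.blockDiagonal fun i : Fin p => (u : Matrix n n ℂ) ^ (i : ℕ), ?_, ?_, ?_⟩
  · rw [← Matrix.blockDiagonal_mul, ← Matrix.blockDiagonal_one]
    congr 1
    ext1 i
    rw [← Units.val_pow_eq_pow_val, ← Units.val_pow_eq_pow_val, ← Units.val_mul]
    simp
  · rw [← Matrix.blockDiagonal_mul, ← Matrix.blockDiagonal_one]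
    congr 1
    ext1 i
    rw [← Units.val_pow_eq_pow_val, ← Units.val_pow_eq_pow_val, ← Units.val_mul]
    simp
  · rw [Matrix.add_mul, Matrix.mul_add, Matrix.kronecker_one, ← Matrix.blockDiagonal_mul,
      ← Matrix.blockDiagonal_mul]
    congr 1
    · ext ⟨x, i⟩ ⟨y, j⟩
      have h1 : ((u : Matrix n n ℂ) ⊗ₖ jordanCell p 0 *
          Matrix.blockDiagonal fun i : Fin p => (↑u⁻¹ : Matrix n n ℂ) ^ (i : ℕ)) (x, i) (y, j)
          = jordanCell p 0 i j * ((u : Matrix n n ℂ) * (↑u⁻¹ : Matrix n n ℂ) ^ (j : ℕ)) x y := by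
        simp [Matrix.mul_apply, Fintype.sum_prod_type, Finset.mul_sum,
          Matrix.blockDiagonal_apply, mul_assoc, mul_left_comm]
      have h2 : ((Matrix.blockDiagonal fun i : Fin p => (↑u⁻¹ : Matrix n n ℂ) ^ (i : ℕ)) *
          (1 : Matrix n n ℂ) ⊗ₖ jordanCell p 0) (x, i) (y, j)
          = jordanCell p 0 i j * ((↑u⁻¹ : Matrix n n ℂ) ^ (i : ℕ)) x y := by
        simp [Matrix.mul_apply, Fintype.sum_prod_type, Matrix.one_apply,
          Matrix.blockDiagonal_apply, mul_comm]
      rw [h1, h2]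
      by_cases hij : (i : ℕ) + 1 = j
      · rw [← hij, pow_succ', ← mul_assoc, Units.mul_inv, one_mul]
      · simp [jordanCell, hij]
    · congr 1
      ext1 i
      exact (hYi.pow_left _).eq.symm

/-! ### Nilpotent cells and Jordan chains -/

theorem jordanCell_zero_apply {n : ℕ} (i j : Fin n) :
    jordanCell n 0 i j = if (i : ℕ) + 1 = j then 1 else 0 := by
  by_cases h : i = j
  · subst h
    simp [jordanCell]
  · simp [jordanCell, h]

theorem jordanCell_eq_smul_one_add (n : ℕ) (a : ℂ) :
    jordanCell n a = a • 1 + jordanCell n 0 := by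
  ext i j
  by_cases h : i = j
  · subst h
    simp [jordanCell]
  · simp [jordanCell, h]

theorem sum_jordanCell_zero_smul {n : ℕ} {V : Type*} [AddCommGroup V] [Module ℂ V]
    (j : Fin n) (w : Fin n → V) :
    ∑ i, jordanCell n 0 i j • w i =
      if 0 < (j : ℕ) then w ⟨(j : ℕ) - 1, by omega⟩ else 0 := by
  simp only [jordanCell_zero_apply, ite_smul, one_smul, zero_smul]
  split_ifs with h
  · rw [Finset.sum_eq_single ⟨(j : ℕ) - 1, by omega⟩]
    · rw [if_pos (show (j : ℕ) - 1 + 1 = j by omega)]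
    · intro i _ hi
      rw [if_neg]
      intro h'
      exact hi (Fin.ext (show (i : ℕ) = (j : ℕ) - 1 by omega))
    · simp
  · exact Finset.sum_eq_zero fun i _ => if_neg (by omega)

theorem sum_blockDiagonal'_smul {κ : Type*} [Fintype κ] [DecidableEq κ] {ι : κ → Type*}
    [∀ k, Fintype (ι k)] {V : Type*} [AddCommGroup V] [Module ℂ V]
    (M : ∀ k, Matrix (ι k) (ι k) ℂ) (k : κ) (j : ι k) (w : (Σ k, ι k) → V) :
    ∑ x, Matrix.blockDiagonal' M x ⟨k, j⟩ • w x = ∑ i, M k i j • w ⟨k, i⟩ := by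
  rw [Fintype.sum_sigma, Finset.sum_eq_single k]
  · simp
  · intro l _ hl
    exact Finset.sum_eq_zero fun i _ => by rw [Matrix.blockDiagonal'_apply_ne _ _ _ hl, zero_smul]
  · simp

/-- Jordan chains with linearly independent ends are jointly linearly independent. -/
theorem linearIndependent_chains {K V κ : Type*} [Field K] [AddCommGroup V] [Module K V]
    [Fintype κ] (N : Module.End K V) (n : κ → ℕ) (w : (Σ k, Fin (n k)) → V) (z : κ → V)
    (hz : LinearIndependent K z)
    (hw : ∀ k (j : Fin (n k)), (N ^ (j : ℕ)) (w ⟨k, j⟩) = z k) (hN : ∀ k, N (z k) = 0) :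
    LinearIndependent K w := by
  rw [Fintype.linearIndependent_iff]
  intro g hg
  have hlt : ∀ k (j : Fin (n k)) (r : ℕ), (j : ℕ) < r → (N ^ r) (w ⟨k, j⟩) = 0 := by
    intro k j r h
    obtain ⟨d, rfl⟩ := Nat.exists_eq_add_of_lt h
    rw [show (j : ℕ) + d + 1 = d + 1 + j by ring, pow_add, Module.End.mul_apply, hw, pow_succ,
      Module.End.mul_apply, hN, map_zero]
  obtain ⟨R, hR⟩ : ∃ R, ∀ k, n k ≤ R :=
    ⟨Finset.univ.sup n, fun k => Finset.le_sup (Finset.mem_univ k)⟩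
  -- Downward induction on the position `r`. Once the coefficients beyond `r` vanish, `N ^ r` kills
  -- all terms before `r` and sends those at `r` to the independent ends `z k`.
  suffices h : ∀ d r, R ≤ r + d → ∀ k (j : Fin (n k)), r ≤ j → g ⟨k, j⟩ = 0 from
    fun ⟨k, j⟩ => h R 0 (by omega) k j (Nat.zero_le _)
  intro d
  induction d with
  | zero =>
    intro r hr k j hj
    have := hR k
    omega
  | succ d ih =>
    intro r hr
    have hgt := ih (r + 1) (by omega)
    have key : ∑ k, (if h : r < n k then g ⟨k, ⟨r, h⟩⟩ else 0) • z k = 0 := by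
      have h0 := congrArg (N ^ r) hg
      rw [map_sum, map_zero, Fintype.sum_sigma] at h0
      rw [← h0]
      refine Finset.sum_congr rfl fun k _ => ?_
      split_ifs with h
      · rw [Finset.sum_eq_single ⟨r, h⟩]
        · rw [map_smul, hw k ⟨r, h⟩]
        · intro j _ hj
          rcases lt_or_ge (j : ℕ) r with h' | h'
          · rw [map_smul, hlt k j r h', smul_zero]
          · rw [hgt k j (by
              have : (j : ℕ) ≠ r := fun h => hj (Fin.ext h)
              omega), zero_smul, map_zero]
        · simp
      · rw [zero_smul, eq_comm]
        exact Finset.sum_eq_zero fun j _ => by rw [map_smul, hlt k j r (by omega), smul_zero]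
    intro k j hj
    rcases eq_or_lt_of_le hj with h | h
    · have := Fintype.linearIndependent_iff.1 hz _ key k
      rw [dif_pos (h ▸ j.2)] at this
      convert this
      exact h.symm
    · exact hgt k j h

/-- A matrix with nilpotent Jordan chains that fill the space is a direct sum of Jordan cells. -/
theorem Intertwined.of_chains {m κ : Type*} [Fintype m] [DecidableEq m] [Fintype κ]
    [DecidableEq κ] [Nonempty κ] (N : Matrix m m ℂ) (n : κ → ℕ) (hn : ∀ k, 0 < n k)
    (v : κ → m → ℂ) (hv : ∀ k, (N ^ n k).mulVec (v k) = 0)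
    (hend : LinearIndependent ℂ fun k => (N ^ (n k - 1)).mulVec (v k))
    (hcard : ∑ k, n k = Fintype.card m) :
    Intertwined N (Matrix.blockDiagonal' fun k => jordanCell (n k) 0) := by
  have hstep : ∀ k r, N.mulVec ((N ^ r).mulVec (v k)) = (N ^ (r + 1)).mulVec (v k) :=
    fun k r => by rw [Matrix.mulVec_mulVec, pow_succ']
  have : Nonempty (Σ k, Fin (n k)) := ⟨⟨Classical.arbitrary κ, ⟨0, hn _⟩⟩⟩
  -- The chain is listed backwards, its end at index `0`, because a superdiagonal cell sends `e_j`
  -- to `e_{j-1}`.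
  refine Intertwined.of_linearIndependent
    (fun x => (N ^ (n x.1 - 1 - (x.2 : ℕ))).mulVec (v x.1)) ?_ ?_ ?_
  · refine linearIndependent_chains (Matrix.toLin' N) n _ _ hend ?_ ?_
    · intro k j
      rw [← Matrix.toLin'_pow, Matrix.toLin'_apply, Matrix.mulVec_mulVec, ← pow_add]
      have := j.2
      congr 3
      dsimp only
      omega
    · intro k
      rw [Matrix.toLin'_apply, hstep, Nat.sub_add_cancel (hn k), hv]
  · simpa using hcard
  · rintro ⟨k, j⟩
    rw [sum_blockDiagonal'_smul (fun k => jordanCell (n k) 0), sum_jordanCell_zero_smul]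
    have hj := j.2
    dsimp only
    rw [hstep]
    split_ifs with h
    · congr 3
      omega
    · rw [show n k - 1 - (j : ℕ) + 1 = n k by omega, hv]

/-! ### Highest weight vectors for `sl₂`: `E` lowers weights, `F` raises them -/

section Sl2

variable {m : Type*} [Fintype m] [DecidableEq m] {E F H : Matrix m m ℂ} {v : m → ℂ} {c : ℂ}

theorem mulVec_weight_pow (hHE : H * E - E * H = -(2 : ℂ) • E) (hv : H.mulVec v = c • v) (r : ℕ) :
    H.mulVec ((E ^ r).mulVec v) = (c - 2 * r) • (E ^ r).mulVec v := by
  induction r with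
  | zero => simpa using hv
  | succ r ih =>
    have h : H * E = E * H - (2 : ℂ) • E := by
      rw [sub_eq_iff_eq_add'.1 hHE, neg_smul, ← sub_eq_add_neg]
    rw [pow_succ', ← Matrix.mulVec_mulVec, Matrix.mulVec_mulVec, h, Matrix.sub_mulVec,
      ← Matrix.mulVec_mulVec, ih, Matrix.mulVec_smul, Matrix.smul_mulVec, ← sub_smul]
    congr 1
    push_cast
    ring

theorem mulVec_raise_pow (hFE : F * E - E * F = H) (hHE : H * E - E * H = -(2 : ℂ) • E)
    (hv : H.mulVec v = c • v) (hF : F.mulVec v = 0) (r : ℕ) :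
    F.mulVec ((E ^ (r + 1)).mulVec v) = ((r + 1) * (c - r)) • (E ^ r).mulVec v := by
  have h : F * E = E * F + H := by rw [← hFE]; abel
  induction r with
  | zero =>
    rw [zero_add, pow_one, Matrix.mulVec_mulVec, h, Matrix.add_mulVec, ← Matrix.mulVec_mulVec, hF,
      hv]
    simp
  | succ r ih =>
    rw [pow_succ' E (r + 1), ← Matrix.mulVec_mulVec, Matrix.mulVec_mulVec, h, Matrix.add_mulVec,
      ← Matrix.mulVec_mulVec, ih, mulVec_weight_pow hHE hv, Matrix.mulVec_smul,
      Matrix.mulVec_mulVec, ← pow_succ', ← add_smul]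
    congr 1
    push_cast
    ring

/-- For `r < k` the factor `(r + 1) (k - r)` is nonzero, so `F` brings `E ^ (r + 1) v` back to a
nonzero multiple of `E ^ r v`. -/
theorem mulVec_pow_ne_zero (hFE : F * E - E * F = H) (hHE : H * E - E * H = -(2 : ℂ) • E)
    {k : ℕ} (hv : H.mulVec v = (k : ℂ) • v) (hF : F.mulVec v = 0) (hv0 : v ≠ 0) {r : ℕ}
    (hr : r ≤ k) : (E ^ r).mulVec v ≠ 0 := by
  induction r with
  | zero => simpa using hv0
  | succ r ih =>
    intro h
    have h1 := mulVec_raise_pow hFE hHE hv hF r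
    rw [h, Matrix.mulVec_zero, eq_comm, smul_eq_zero, mul_eq_zero] at h1
    rcases h1 with (h1 | h1) | h1
    · exact Nat.cast_add_one_ne_zero r h1
    · rw [sub_eq_zero, Nat.cast_inj] at h1
      omega
    · exact ih (by omega) h1

/-- The factor `(r + 1) (k - r)` is also nonzero for `r > k`, so vanishing of a high power on `v`,
given by nilpotency, descends to the exponent `k + 1`. -/
theorem mulVec_pow_eq_zero (hFE : F * E - E * F = H) (hHE : H * E - E * H = -(2 : ℂ) • E)
    {k : ℕ} (hv : H.mulVec v = (k : ℂ) • v) (hF : F.mulVec v = 0) (hE : IsNilpotent E) :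
    (E ^ (k + 1)).mulVec v = 0 := by
  obtain ⟨R, hR⟩ := hE
  suffices h : ∀ d, (E ^ (k + 1 + d)).mulVec v = 0 → (E ^ (k + 1)).mulVec v = 0 from
    h R (by rw [pow_add, hR, mul_zero, Matrix.zero_mulVec])
  intro d
  induction d with
  | zero => exact id
  | succ d ih =>
    intro h
    apply ih
    have h1 := mulVec_raise_pow hFE hHE hv hF (k + 1 + d)
    rw [add_assoc (k + 1) d 1, h, Matrix.mulVec_zero, eq_comm, smul_eq_zero, mul_eq_zero] at h1
    rcases h1 with (h1 | h1) | h1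
    · exact absurd h1 (Nat.cast_add_one_ne_zero _)
    · rw [sub_eq_zero, Nat.cast_inj] at h1
      omega
    · exact h1

end Sl2

/-! ### The irreducible representations and their tensor products -/

/-- The operator that together with `J_n(0)` generates the irreducible representation of `sl₂` of
dimension `n`. -/
def raisingCell (n : ℕ) : Matrix (Fin n) (Fin n) ℂ :=
  Matrix.of fun i j => if (j : ℕ) + 1 = i then (i : ℂ) * (n - i) else 0

/-- The weights of the irreducible representation of `sl₂` of dimension `n`. -/
def weightCell (n : ℕ) : Matrix (Fin n) (Fin n) ℂ :=
  Matrix.diagonal fun i => 2 * (i : ℂ) - (n - 1)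

theorem jordanCell_zero_mulVec {n : ℕ} (g : Fin n → ℂ) (i : Fin n) :
    (jordanCell n 0).mulVec g i = if h : (i : ℕ) + 1 < n then g ⟨i + 1, h⟩ else 0 := by
  simp only [Matrix.mulVec, dotProduct, jordanCell_zero_apply, ite_mul, one_mul, zero_mul]
  split_ifs with h
  · rw [Finset.sum_eq_single ⟨i + 1, h⟩]
    · simp
    · intro j _ hj
      exact if_neg fun h' => hj (Fin.ext h'.symm)
    · simp
  · exact Finset.sum_eq_zero fun j _ => if_neg (by omega)

theorem raisingCell_mulVec {n : ℕ} (g : Fin n → ℂ) (i : Fin n) :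
    (raisingCell n).mulVec g i =
      if 0 < (i : ℕ) then (i : ℂ) * (n - i) * g ⟨i - 1, by omega⟩ else 0 := by
  simp only [Matrix.mulVec, dotProduct, raisingCell, Matrix.of_apply, ite_mul, zero_mul]
  split_ifs with h
  · rw [Finset.sum_eq_single ⟨i - 1, by omega⟩]
    · rw [if_pos (show (i : ℕ) - 1 + 1 = i by omega)]
    · intro j _ hj
      exact if_neg fun h' => hj (Fin.ext (show (j : ℕ) = i - 1 by omega))
    · simp
  · exact Finset.sum_eq_zero fun j _ => if_neg (by omega)

theorem weightCell_mulVec {n : ℕ} (g : Fin n → ℂ) (i : Fin n) :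
    (weightCell n).mulVec g i = (2 * (i : ℂ) - (n - 1)) * g i := by
  rw [weightCell, Matrix.mulVec_diagonal]

/-- Rests on `i (n - i) - (i + 1) (n - i - 1) = 2 i - (n - 1)`. The boundary rows fit because `i (n
- i)` vanishes at `i = 0` and `i = n`. -/
theorem raisingCell_lie_jordanCell (n : ℕ) :
    raisingCell n * jordanCell n 0 - jordanCell n 0 * raisingCell n = weightCell n := by
  apply Matrix.toLin'.injective
  refine LinearMap.ext fun g => funext fun i => ?_
  simp only [map_sub, LinearMap.sub_apply, Matrix.toLin'_apply, Pi.sub_apply,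
    ← Matrix.mulVec_mulVec, weightCell_mulVec, raisingCell_mulVec, jordanCell_zero_mulVec]
  have hi := i.2
  have e₁ : ∀ h : (i : ℕ) - 1 + 1 < n, 0 < (i : ℕ) → g ⟨i - 1 + 1, h⟩ = g i := fun h h' =>
    congrArg g (Fin.ext (by simp only; omega))
  have e₂ : ∀ h : (i : ℕ) + 1 - 1 < n, g ⟨i + 1 - 1, h⟩ = g i := fun _ => rfl
  have last : ¬ (i : ℕ) + 1 < n → (n : ℂ) = i + 1 := fun h => by
    exact_mod_cast show n = i + 1 by omega
  have first : ¬ 0 < (i : ℕ) → (i : ℂ) = 0 := fun h => by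
    exact_mod_cast show (i : ℕ) = 0 by omega
  have h₁ : (if 0 < (i : ℕ) then (i : ℂ) * (n - i) *
      (if h : (i : ℕ) - 1 + 1 < n then g ⟨i - 1 + 1, h⟩ else 0) else 0)
      = (i : ℂ) * (n - i) * g i := by
    split_ifs with h h'
    · rw [e₁ h' h]
    · omega
    · rw [first h]
      ring
  rw [h₁]
  split_ifs with h h'
  · rw [e₂]
    push_cast
    ring
  · omega
  · rw [last h]
    ring

theorem weightCell_lie_jordanCell (n : ℕ) :
    weightCell n * jordanCell n 0 - jordanCell n 0 * weightCell n
      = -(2 : ℂ) • jordanCell n 0 := by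
  ext i j
  simp only [weightCell, Matrix.sub_apply, Matrix.diagonal_mul, Matrix.mul_diagonal,
    Matrix.smul_apply, jordanCell_zero_apply]
  split_ifs with h
  · rw [← h]
    push_cast
    simp only [smul_eq_mul]
    ring
  · simp

theorem jordanCell_zero_isNilpotent (n : ℕ) : IsNilpotent (jordanCell n 0) := by
  refine ⟨n, ?_⟩
  have h : ∀ r (g : Fin n → ℂ) (i : Fin n),
      n ≤ i + r → ((jordanCell n 0) ^ r).mulVec g i = 0 := by
    intro r
    induction r with
    | zero => intro g i hi; omega
    | succ r ih =>
      intro g i hi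
      rw [pow_succ', ← Matrix.mulVec_mulVec, jordanCell_zero_mulVec]
      split_ifs with h
      · exact ih g _ (by simp only; omega)
      · rfl
  apply Matrix.toLin'.injective
  refine LinearMap.ext fun g => funext fun i => ?_
  rw [Matrix.toLin'_apply, h n g i (by omega), map_zero]
  rfl

section KroneckerSum

variable {m n : Type*} [Fintype m] [Fintype n] [DecidableEq m] [DecidableEq n]

theorem kroneckerSum_mulVec (A : Matrix m m ℂ) (B : Matrix n n ℂ) (g : m × n → ℂ) (i : m) (j : n) :
    (A ⊗ₖ 1 + 1 ⊗ₖ B).mulVec g (i, j) =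
      A.mulVec (fun i' => g (i', j)) i + B.mulVec (fun j' => g (i, j')) j := by
  simp [Matrix.mulVec, dotProduct, Fintype.sum_prod_type, add_mul, Finset.sum_add_distrib,
    Matrix.one_apply]

/-- The mixed terms `A ⊗ B'` and `A' ⊗ B` occur in both products and cancel, so `sl₂` relations pass
to the tensor product. -/
theorem kroneckerSum_lie (A A' : Matrix m m ℂ) (B B' : Matrix n n ℂ) :
    (A ⊗ₖ 1 + 1 ⊗ₖ B) * (A' ⊗ₖ 1 + 1 ⊗ₖ B') - (A' ⊗ₖ 1 + 1 ⊗ₖ B') * (A ⊗ₖ 1 + 1 ⊗ₖ B)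
      = (A * A' - A' * A) ⊗ₖ 1 + 1 ⊗ₖ (B * B' - B' * B) := by
  simp only [Matrix.add_mul, Matrix.mul_add, ← Matrix.mul_kronecker_mul, Matrix.mul_one,
    Matrix.one_mul]
  ext ⟨i, j⟩ ⟨i', j'⟩
  simp only [Matrix.add_apply, Matrix.sub_apply, Matrix.kronecker_apply]
  ring

theorem kroneckerSum_isNilpotent {A : Matrix m m ℂ} {B : Matrix n n ℂ} (hA : IsNilpotent A)
    (hB : IsNilpotent B) : IsNilpotent (A ⊗ₖ (1 : Matrix n n ℂ) + (1 : Matrix m m ℂ) ⊗ₖ B) := by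
  have hA' : ∀ r, (A ⊗ₖ (1 : Matrix n n ℂ)) ^ r = (A ^ r) ⊗ₖ 1 := fun r => by
    induction r with
    | zero => simp
    | succ r ih => rw [pow_succ, ih, ← Matrix.mul_kronecker_mul, pow_succ, Matrix.mul_one]
  have hB' : ∀ r, ((1 : Matrix m m ℂ) ⊗ₖ B) ^ r = 1 ⊗ₖ (B ^ r) := fun r => by
    induction r with
    | zero => simp
    | succ r ih => rw [pow_succ, ih, ← Matrix.mul_kronecker_mul, pow_succ, Matrix.mul_one]
  refine Commute.isNilpotent_add ?_ ?_ ?_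
  · rw [Commute, SemiconjBy, ← Matrix.mul_kronecker_mul, ← Matrix.mul_kronecker_mul]
    simp
  · obtain ⟨r, hr⟩ := hA
    exact ⟨r, by rw [hA', hr, Matrix.zero_kronecker]⟩
  · obtain ⟨r, hr⟩ := hB
    exact ⟨r, by rw [hB', hr, Matrix.kronecker_zero]⟩

end KroneckerSum

/-! ### Primitive vectors and the Clebsch-Gordan decomposition -/

/-- The coefficients of the lowest weight vectors of a tensor product of two irreducible
representations of `sl₂`, up to sign. -/
noncomputable def primitiveCoeff (n i : ℕ) : ℂ :=
  ∏ t ∈ Finset.range i, (((t + 1 : ℕ) : ℂ) * (n - (t + 1 : ℕ)))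

theorem primitiveCoeff_pred (n i : ℕ) (hi : 0 < i) :
    primitiveCoeff n i = i * (n - i) * primitiveCoeff n (i - 1) := by
  obtain ⟨i, rfl⟩ := Nat.exists_eq_succ_of_ne_zero hi.ne'
  rw [primitiveCoeff, Finset.prod_range_succ, mul_comm]
  rfl

theorem primitiveCoeff_ne_zero {n i : ℕ} (hi : i < n) : primitiveCoeff n i ≠ 0 := by
  refine Finset.prod_ne_zero_iff.2 fun t ht => mul_ne_zero (by exact_mod_cast Nat.succ_ne_zero t) ?_
  rw [sub_ne_zero, Ne, Nat.cast_inj]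
  have := Finset.mem_range.1 ht
  omega

/-- The primitive vector of weight `p + q - 2 - 2 k` in the tensor product of the irreducible
representations of `sl₂` of dimensions `p` and `q`. -/
noncomputable def primitiveVector (p q k : ℕ) : Fin p × Fin q → ℂ := fun x =>
  if (x.1 : ℕ) + x.2 + k + 2 = p + q then
    (-1) ^ (x.1 : ℕ) * primitiveCoeff p x.1 * primitiveCoeff q x.2 else 0

theorem primitiveVector_ne_zero {p q k : ℕ} (hp : k < p) (hq : k < q) :
    primitiveVector p q k ≠ 0 := by
  intro h
  have h1 := congrFun h (⟨p - 1, by omega⟩, ⟨q - 1 - k, by omega⟩)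
  rw [primitiveVector, if_pos (by simp only; omega)] at h1
  exact mul_ne_zero (mul_ne_zero (pow_ne_zero _ (by norm_num))
    (primitiveCoeff_ne_zero (by simp only; omega))) (primitiveCoeff_ne_zero (by simp only; omega)) h1

theorem weight_mulVec_primitiveVector {p q k : ℕ} (hp : k < p) (hq : k < q) :
    (weightCell p ⊗ₖ 1 + 1 ⊗ₖ weightCell q).mulVec (primitiveVector p q k)
      = ((p + q - 2 - 2 * k : ℕ) : ℂ) • primitiveVector p q k := by
  ext ⟨i, j⟩
  rw [kroneckerSum_mulVec, weightCell_mulVec, weightCell_mulVec, Pi.smul_apply, smul_eq_mul,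
    ← add_mul]
  by_cases h : (i : ℕ) + j + k + 2 = p + q
  · congr 1
    rw [Nat.sub_sub, Nat.cast_sub (by omega)]
    have h' : (i : ℂ) + j + k + 2 = p + q := by exact_mod_cast h
    push_cast
    linear_combination 2 * h'
  · simp [primitiveVector, h]

theorem raising_mulVec_primitiveVector {p q k : ℕ} (hp : k < p) (hq : k < q) :
    (raisingCell p ⊗ₖ 1 + 1 ⊗ₖ raisingCell q).mulVec (primitiveVector p q k) = 0 := by
  ext ⟨i, j⟩
  have hi := i.2
  have hj := j.2
  rw [kroneckerSum_mulVec, raisingCell_mulVec, raisingCell_mulVec, Pi.zero_apply]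
  -- On this antidiagonal `k < p` and `k < q` force `i, j > 0`. Both terms then have absolute value
  -- that of `primitiveCoeff p i * primitiveCoeff q j`, with opposite signs.
  by_cases h : (i : ℕ) + j + k + 1 = p + q
  · have hi0 : 0 < (i : ℕ) := by omega
    have hj0 : 0 < (j : ℕ) := by omega
    rw [if_pos hi0, if_pos hj0, primitiveVector, primitiveVector, if_pos (by simp only; omega),
      if_pos (by simp only; omega)]
    simp only
    rw [primitiveCoeff_pred p i hi0, primitiveCoeff_pred q j hj0]
    obtain ⟨r, hr⟩ := Nat.exists_eq_succ_of_ne_zero hi0.ne'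
    rw [hr, Nat.succ_sub_one, pow_succ]
    ring
  · have h1 : ∀ x : Fin p × Fin q, (x.1 : ℕ) + x.2 + 1 = i + j → primitiveVector p q k x = 0 :=
      fun x hx => if_neg (by omega)
    split_ifs with h2 h3 h3
    · rw [h1 _ (by simp only; omega), h1 _ (by simp only; omega)]
      simp
    · rw [h1 _ (by simp only; omega)]
      simp
    · rw [h1 _ (by simp only; omega)]
      simp
    · simp

theorem sum_cell_sizes (p q : ℕ) (r : ℕ) (hp : r ≤ p) (hq : r ≤ q) :
    ∑ k ∈ Finset.range r, (p + q - 2 * (k + 1) + 1) = r * (p + q - r) := by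
  induction r with
  | zero => simp
  | succ r ih =>
    rw [Finset.sum_range_succ, ih (by omega) (by omega)]
    obtain ⟨s, rfl⟩ := Nat.exists_eq_add_of_le hp
    obtain ⟨t, rfl⟩ := Nat.exists_eq_add_of_le hq
    rw [show r + 1 + s + (r + 1 + t) - r = r + 2 + s + t by omega,
      show r + 1 + s + (r + 1 + t) - 2 * (r + 1) = s + t by omega,
      show r + 1 + s + (r + 1 + t) - (r + 1) = r + 1 + s + t by omega]
    ring

theorem min_mul_add_sub_min (p q : ℕ) : min p q * (p + q - min p q) = p * q := by
  rcases le_total p q with h | h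
  · rw [min_eq_left h, Nat.add_sub_cancel_left]
  · rw [min_eq_right h, Nat.add_sub_cancel, mul_comm]

theorem Intertwined.kroneckerSum_jordanCell_zero {p q : ℕ} (hp : 0 < p) (hq : 0 < q) :
    Intertwined (jordanCell p 0 ⊗ₖ 1 + 1 ⊗ₖ jordanCell q 0)
      (Matrix.blockDiagonal' fun k : Fin (min p q) =>
        jordanCell (p + q - 2 * ((k : ℕ) + 1) + 1) 0) := by
  have : Nonempty (Fin (min p q)) := ⟨⟨0, by omega⟩⟩
  have hFE := kroneckerSum_lie (raisingCell p) (jordanCell p 0) (raisingCell q) (jordanCell q 0)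
  rw [raisingCell_lie_jordanCell, raisingCell_lie_jordanCell] at hFE
  have hHE := kroneckerSum_lie (weightCell p) (jordanCell p 0) (weightCell q) (jordanCell q 0)
  rw [weightCell_lie_jordanCell, weightCell_lie_jordanCell, Matrix.smul_kronecker,
    Matrix.kronecker_smul, ← smul_add] at hHE
  have hnil := kroneckerSum_isNilpotent (jordanCell_zero_isNilpotent p)
    (jordanCell_zero_isNilpotent q)
  have hkp : ∀ k : Fin (min p q), (k : ℕ) < p := fun k => k.2.trans_le (min_le_left _ _)
  have hkq : ∀ k : Fin (min p q), (k : ℕ) < q := fun k => k.2.trans_le (min_le_right _ _)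
  have hw : ∀ k : Fin (min p q), p + q - 2 * ((k : ℕ) + 1) = p + q - 2 - 2 * k := by omega
  refine Intertwined.of_chains _ (fun k : Fin (min p q) => p + q - 2 * ((k : ℕ) + 1) + 1)
    (fun k => Nat.succ_pos _) (fun k => primitiveVector p q k) (fun k => ?_) ?_ ?_
  · simp only [hw]
    exact mulVec_pow_eq_zero hFE hHE (weight_mulVec_primitiveVector (hkp k) (hkq k))
      (raising_mulVec_primitiveVector (hkp k) (hkq k)) hnil
  · simp only [hw, Nat.add_sub_cancel]
    -- Lowering `w = p + q - 2 - 2k` times from weight `w` ends at weight `w - 2w = -w`, and these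
    -- are distinct.
    refine Module.End.eigenvectors_linearIndependent'
      (Matrix.toLin' (weightCell p ⊗ₖ 1 + 1 ⊗ₖ weightCell q))
      (fun k : Fin (min p q) => ((p + q - 2 - 2 * k : ℕ) : ℂ) - 2 * ((p + q - 2 - 2 * k : ℕ) : ℂ))
      ?_ _ fun k => ⟨?_, ?_⟩
    · intro k l h
      have h' : ((p + q - 2 - 2 * k : ℕ) : ℂ) = ((p + q - 2 - 2 * l : ℕ) : ℂ) := by
        linear_combination -h
      rw [Nat.cast_inj] at h'
      have := hkp k
      have := hkq k
      have := hkp l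
      have := hkq l
      exact Fin.ext (by omega)
    · rw [Module.End.mem_eigenspace_iff, Matrix.toLin'_apply]
      exact mulVec_weight_pow hHE (weight_mulVec_primitiveVector (hkp k) (hkq k)) _
    · exact mulVec_pow_ne_zero hFE hHE (weight_mulVec_primitiveVector (hkp k) (hkq k))
        (raising_mulVec_primitiveVector (hkp k) (hkq k))
        (primitiveVector_ne_zero (hkp k) (hkq k)) le_rfl
  · rw [Fin.sum_univ_eq_sum_range (fun k => p + q - 2 * (k + 1) + 1),
      sum_cell_sizes p q _ (min_le_left _ _) (min_le_right _ _), min_mul_add_sub_min]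
    simp

/-! ### Cells with nonzero eigenvalue -/

theorem jordanCell_isUnit (n : ℕ) {a : ℂ} (ha : a ≠ 0) : IsUnit (jordanCell n a) := by
  rw [jordanCell_eq_smul_one_add, add_comm]
  refine (jordanCell_zero_isNilpotent n).isUnit_add_right_of_commute ?_ ?_
  · exact ⟨⟨a • 1, a⁻¹ • 1, by simp [smul_smul, ha], by simp [smul_smul, ha]⟩, rfl⟩
  · exact (Commute.one_right _).smul_right a

theorem Intertwined.kronecker_jordanCell_zero_of_isUnit (p n : ℕ) {A : Matrix (Fin n) (Fin n) ℂ}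
    (hA : IsUnit A) :
    Intertwined (A ⊗ₖ jordanCell p 0)
      (Matrix.blockDiagonal' fun _ : Fin n => jordanCell p 0) := by
  have h := Intertwined.kronecker_jordanCell_zero p A 0 hA (Commute.zero_right A)
  rw [Matrix.zero_kronecker, add_zero, add_zero] at h
  exact h.trans ((Intertwined.kronecker_swap _ _).trans (Intertwined.blockDiagonal'_const _ _))

theorem Intertwined.kroneckerSum_swap {m n : Type*} [Fintype m] [Fintype n] [DecidableEq m]
    [DecidableEq n] (A A' : Matrix m m ℂ) (B B' : Matrix n n ℂ) :
    Intertwined (A ⊗ₖ B + A' ⊗ₖ B') (B' ⊗ₖ A' + B ⊗ₖ A) := by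
  have h : A ⊗ₖ B + A' ⊗ₖ B' = Matrix.reindex (Equiv.prodComm n m) (Equiv.prodComm n m)
      (B' ⊗ₖ A' + B ⊗ₖ A) := by
    ext i j
    simp [mul_comm, add_comm]
  rw [h]
  exact Intertwined.reindex _ _

theorem Intertwined.jordanCell_kronecker {p q : ℕ} (hp : 0 < p) (hq : 0 < q) {a b : ℂ}
    (hab : a * b ≠ 0) :
    Intertwined (jordanCell p a ⊗ₖ jordanCell q b)
      (Matrix.blockDiagonal' fun k : Fin (min p q) =>
        jordanCell (p + q - 2 * ((k : ℕ) + 1) + 1) (a * b)) := by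
  have hD : (Matrix.blockDiagonal' fun k : Fin (min p q) =>
        jordanCell (p + q - 2 * ((k : ℕ) + 1) + 1) (a * b))
      = (a * b) • 1 + Matrix.blockDiagonal' fun k : Fin (min p q) =>
        jordanCell (p + q - 2 * ((k : ℕ) + 1) + 1) 0 := by
    rw [← Matrix.blockDiagonal'_one, ← Matrix.blockDiagonal'_smul, ← Matrix.blockDiagonal'_add]
    congr 1
    ext1 k
    exact jordanCell_eq_smul_one_add _ _
  have hC : jordanCell p a ⊗ₖ jordanCell q b = (a * b) • 1 +
      (jordanCell p a ⊗ₖ jordanCell q 0 + (b • jordanCell p 0) ⊗ₖ 1) := by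
    rw [jordanCell_eq_smul_one_add q b, Matrix.kronecker_add, jordanCell_eq_smul_one_add p a,
      Matrix.kronecker_smul, Matrix.add_kronecker, Matrix.add_kronecker, Matrix.smul_kronecker,
      Matrix.one_kronecker_one, Matrix.smul_kronecker, smul_add, smul_smul, mul_comm b a,
      Matrix.smul_kronecker]
    abel
  rw [hC, hD]
  apply Intertwined.smul_one_add
  have hcomm : Commute (jordanCell p a) (b • jordanCell p 0) := by
    rw [jordanCell_eq_smul_one_add p a]
    exact (((Commute.one_left _).smul_left a).add_left (Commute.refl _)).smul_right b
  have hb : IsUnit (b • (1 : Matrix (Fin q) (Fin q) ℂ)) :=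
    ⟨⟨b • 1, b⁻¹ • 1, by simp [smul_smul, right_ne_zero_of_mul hab],
      by simp [smul_smul, right_ne_zero_of_mul hab]⟩, rfl⟩
  -- Untwist by `J_p(a)`, swap the factors, then move `b` onto the identity factor so that the same
  -- lemma removes it with `B = b • 1`.
  refine (Intertwined.kronecker_jordanCell_zero q _ _
    (jordanCell_isUnit p (left_ne_zero_of_mul hab)) hcomm).trans
    ((Intertwined.kroneckerSum_swap _ _ _ _).trans ?_)
  rw [Matrix.kronecker_smul, ← Matrix.smul_kronecker]
  refine (Intertwined.kronecker_jordanCell_zero p _ _ hb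
    ((Commute.one_left _).smul_left b)).trans ?_
  rw [add_comm (1 ⊗ₖ jordanCell p 0)]
  exact (Intertwined.kroneckerSum_swap _ _ _ _).trans
    (Intertwined.kroneckerSum_jordanCell_zero hp hq)

/-! ### Two nilpotent cells: chains along diagonals -/

/-- The position of the vectors of the Jordan chains of `J_p(0) ⊗ J_q(0)`, which run along the
diagonals of a `p × q` rectangle. -/
def diagonalPosition (p q : ℕ) (hp : 0 < p) (hq : 0 < q) :
    (Σ k : Fin (min p q - 1), Fin ((k : ℕ) + 1) ⊕ Fin ((k : ℕ) + 1)) ⊕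
      (Σ _ : Fin (((p : ℤ) - (q : ℤ)).natAbs + 1), Fin (min p q)) → Fin p × Fin q
  | Sum.inl ⟨k, Sum.inl s⟩ => (⟨s, by omega⟩, ⟨q - 1 - k + s, by omega⟩)
  | Sum.inl ⟨k, Sum.inr s⟩ => (⟨p - 1 - k + s, by omega⟩, ⟨s, by omega⟩)
  -- With truncated subtraction one of `p - q`, `q - p` is `0`, so `t` shifts only along the longer
  -- side.
  | Sum.inr ⟨t, s⟩ => (⟨min (t : ℕ) (p - q) + s, by omega⟩, ⟨min (t : ℕ) (q - p) + s, by omega⟩)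

/-- The difference of the coordinates determines the diagonal: the two corner families lie strictly
on either side of the full-length diagonals. -/
theorem diagonalPosition_injective (p q : ℕ) (hp : 0 < p) (hq : 0 < q) :
    Function.Injective (diagonalPosition p q hp hq) := by
  rintro (⟨⟨k, hk⟩, ⟨s, hs⟩ | ⟨s, hs⟩⟩ | ⟨⟨t, ht⟩, ⟨s, hs⟩⟩)
    (⟨⟨k', hk'⟩, ⟨s', hs'⟩ | ⟨s', hs'⟩⟩ | ⟨⟨t', ht'⟩, ⟨s', hs'⟩⟩) h <;>
  simp only [diagonalPosition, Prod.mk.injEq, Fin.mk.injEq] at h <;>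
  obtain ⟨h₁, h₂⟩ := h <;> try dsimp only at hs hs'
  · obtain rfl : s = s' := h₁
    obtain rfl : k = k' := by omega
    rfl
  · omega
  · omega
  · omega
  · obtain rfl : s = s' := h₂
    obtain rfl : k = k' := by omega
    rfl
  · omega
  · omega
  · omega
  · obtain rfl : t = t' := by omega
    obtain rfl : s = s' := by omega
    rfl

/-- With `m = min p q`, the count is `(m - 1) m + (|p - q| + 1) m = m (m + |p - q|) = m · max p q`.
-/
theorem card_diagonalPosition (p q : ℕ) (hp : 0 < p) (hq : 0 < q) :
    Fintype.card ((Σ k : Fin (min p q - 1), Fin ((k : ℕ) + 1) ⊕ Fin ((k : ℕ) + 1)) ⊕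
      (Σ _ : Fin (((p : ℤ) - (q : ℤ)).natAbs + 1), Fin (min p q)))
      = Fintype.card (Fin p × Fin q) := by
  simp only [Fintype.card_sum, Fintype.card_sigma, Fintype.card_fin, Fintype.card_prod,
    Finset.sum_const, Finset.card_univ, smul_eq_mul]
  rw [Fin.sum_univ_eq_sum_range (fun k => k + 1 + (k + 1))]
  have hsum : ∀ r, ∑ k ∈ Finset.range r, (k + 1 + (k + 1)) = r * (r + 1) := fun r => by
    induction r with
    | zero => rfl
    | succ r ih =>
      rw [Finset.sum_range_succ, ih]
      ring
  rw [hsum, Nat.sub_add_cancel (by omega), ← min_mul_add_sub_min p q, ← Nat.add_mul,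
    mul_comm]
  congr 1
  omega

theorem kronecker_mulVec_single {m n : Type*} [Fintype m] [Fintype n] [DecidableEq m]
    [DecidableEq n] (A : Matrix m m ℂ) (B : Matrix n n ℂ) (x y : m × n) :
    (A ⊗ₖ B).mulVec (Pi.single x 1) y = A y.1 x.1 * B y.2 x.2 := by
  simp

theorem jordanCell_zero_kronecker_mulVec_single_of_eq_zero {p q : ℕ} (x : Fin p × Fin q)
    (h : (x.1 : ℕ) = 0 ∨ (x.2 : ℕ) = 0) :
    (jordanCell p 0 ⊗ₖ jordanCell q 0).mulVec (Pi.single x 1) = 0 := by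
  ext y
  rw [kronecker_mulVec_single, jordanCell_zero_apply, jordanCell_zero_apply, Pi.zero_apply]
  rcases h with h | h <;> simp [h]

theorem jordanCell_zero_kronecker_mulVec_single {p q : ℕ} (x z : Fin p × Fin q)
    (h₁ : (z.1 : ℕ) + 1 = x.1) (h₂ : (z.2 : ℕ) + 1 = x.2) :
    (jordanCell p 0 ⊗ₖ jordanCell q 0).mulVec (Pi.single x 1) = Pi.single z 1 := by
  ext y
  rw [kronecker_mulVec_single, jordanCell_zero_apply, jordanCell_zero_apply, Pi.single_apply,
    ← h₁, ← h₂]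
  simp only [Nat.add_right_cancel_iff, Fin.val_inj, Prod.ext_iff, ite_and]
  split_ifs <;> simp

theorem sum_matDirectSum_inl_smul {m n V : Type*} [Fintype m] [Fintype n] [AddCommGroup V]
    [Module ℂ V] (C : Matrix m m ℂ) (D : Matrix n n ℂ) (j : m) (w : m ⊕ n → V) :
    ∑ x, matDirectSum C D x (Sum.inl j) • w x = ∑ i, C i j • w (Sum.inl i) := by
  simp [matDirectSum]

theorem sum_matDirectSum_inr_smul {m n V : Type*} [Fintype m] [Fintype n] [AddCommGroup V]
    [Module ℂ V] (C : Matrix m m ℂ) (D : Matrix n n ℂ) (j : n) (w : m ⊕ n → V) :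
    ∑ x, matDirectSum C D x (Sum.inr j) • w x = ∑ i, D i j • w (Sum.inr i) := by
  simp [matDirectSum]

theorem Intertwined.jordanCell_zero_kronecker_jordanCell_zero (p q : ℕ) (hp : 0 < p)
    (hq : 0 < q) :
    Intertwined (jordanCell p 0 ⊗ₖ jordanCell q 0)
      (matDirectSum
        (Matrix.blockDiagonal' fun k : Fin (min p q - 1) =>
          matDirectSum (jordanCell ((k : ℕ) + 1) 0) (jordanCell ((k : ℕ) + 1) 0))
        (Matrix.blockDiagonal' fun _ : Fin (((p : ℤ) - (q : ℤ)).natAbs + 1) =>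
          jordanCell (min p q) 0)) := by
  have : Nonempty ((Σ k : Fin (min p q - 1), Fin ((k : ℕ) + 1) ⊕ Fin ((k : ℕ) + 1)) ⊕
      (Σ _ : Fin (((p : ℤ) - (q : ℤ)).natAbs + 1), Fin (min p q))) :=
    ⟨Sum.inr ⟨0, ⟨0, by omega⟩⟩⟩
  refine Intertwined.of_linearIndependent
    (fun x => Pi.single (diagonalPosition p q hp hq x) 1) ?_ (card_diagonalPosition p q hp hq) ?_
  · have h := (Pi.basisFun ℂ (Fin p × Fin q)).linearIndependent.comp _
      (diagonalPosition_injective p q hp hq)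
    convert h using 1
    ext x
    simp
  · rintro (⟨k, j | j⟩ | ⟨t, j⟩)
    · rw [sum_matDirectSum_inl_smul, sum_blockDiagonal'_smul (fun k : Fin (min p q - 1) =>
          matDirectSum (jordanCell ((k : ℕ) + 1) 0) (jordanCell ((k : ℕ) + 1) 0)),
        sum_matDirectSum_inl_smul, sum_jordanCell_zero_smul]
      split_ifs with h
      · apply jordanCell_zero_kronecker_mulVec_single <;> simp only [diagonalPosition] <;> omega
      · apply jordanCell_zero_kronecker_mulVec_single_of_eq_zero
        simp only [diagonalPosition]
        omega
    · rw [sum_matDirectSum_inl_smul, sum_blockDiagonal'_smul (fun k : Fin (min p q - 1) =>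
          matDirectSum (jordanCell ((k : ℕ) + 1) 0) (jordanCell ((k : ℕ) + 1) 0)),
        sum_matDirectSum_inr_smul, sum_jordanCell_zero_smul]
      split_ifs with h
      · apply jordanCell_zero_kronecker_mulVec_single <;> simp only [diagonalPosition] <;> omega
      · apply jordanCell_zero_kronecker_mulVec_single_of_eq_zero
        simp only [diagonalPosition]
        omega
    · rw [sum_matDirectSum_inr_smul, sum_blockDiagonal'_smul
          (fun _ : Fin (((p : ℤ) - (q : ℤ)).natAbs + 1) => jordanCell (min p q) 0),
        sum_jordanCell_zero_smul]
      split_ifs with h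
      · apply jordanCell_zero_kronecker_mulVec_single <;> simp only [diagonalPosition] <;> omega
      · apply jordanCell_zero_kronecker_mulVec_single_of_eq_zero
        simp only [diagonalPosition]
        omega

theorem theorem4p10 (p q : ℕ) (hp : 0 < p) (hq : 0 < q) (a b : ℂ) :
    (a * b ≠ 0 →
      MatSimilar (tensorProductMap p q (jordanCell p a ⊗ₖ jordanCell q b))
        (Matrix.blockDiagonal' fun k : Fin (min p q) =>
          jordanCell (p + q - 2 * ((k : ℕ) + 1) + 1) (a * b))) ∧
    (a ≠ 0 →
      MatSimilar (tensorProductMap p q (jordanCell p a ⊗ₖ jordanCell q 0))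
        (Matrix.blockDiagonal' fun _ : Fin p => jordanCell q 0)) ∧
    (b ≠ 0 →
      MatSimilar (tensorProductMap p q (jordanCell p 0 ⊗ₖ jordanCell q b))
        (Matrix.blockDiagonal' fun _ : Fin q => jordanCell p 0)) ∧
    MatSimilar (tensorProductMap p q (jordanCell p 0 ⊗ₖ jordanCell q 0))
      (matDirectSum
        (Matrix.blockDiagonal' fun k : Fin (min p q - 1) =>
          matDirectSum (jordanCell ((k : ℕ) + 1) 0) (jordanCell ((k : ℕ) + 1) 0))
        (Matrix.blockDiagonal' fun _ : Fin (((p : ℤ) - (q : ℤ)).natAbs + 1) =>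
          jordanCell (min p q) 0)) := by
  refine ⟨fun hab => ?_, fun ha => ?_, fun hb => ?_, ?_⟩
  · exact (Intertwined.jordanCell_kronecker hp hq hab).matSimilar_tensorProductMap
  · exact (Intertwined.kronecker_jordanCell_zero_of_isUnit q p
      (jordanCell_isUnit p ha)).matSimilar_tensorProductMap
  · exact ((Intertwined.kronecker_swap _ _).trans
      (Intertwined.kronecker_jordanCell_zero_of_isUnit p q
        (jordanCell_isUnit q hb))).matSimilar_tensorProductMap
  · exact (Intertwined.jordanCell_zero_kronecker_jordanCell_zero p q
      hp hq).matSimilar_tensorProductMap
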